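/- Let $\alpha>1/2$, $\lambda>0$ and $H=\alpha-\tfrac12$. Let $\eta$ be Gaussian white noise on $\mathbb R$ (a centred Gaussian family $\eta(A)$, indexed by the Borel sets of finite Lebesgue measure, with $\langle\eta(A)\eta(B)\rangle=|A\cap B|$), and write $\int f(u)\,\eta(u)\,du$ for the associated stochastic integral of $f\in L^2(\mathbb R)$. Let $$X_{\alpha,\lambda}(t)=\frac1{\Gamma(\alpha)}\int_{-\infty}^t e^{-\lambda(t-u)}(t-u)^{\alpha-1}\,\eta(u)\,du ,\qquad t\in\mathbb R,$$ be the Weyl-type fractional Ornstein–Uhlenbeck process, and let $B_{\alpha,\lambda}(t)=X_{\alpha,\lambda}(t)-X_{\alpha,\lambda}(0)$ be the reduced process. Let $K_\nu(z)=\int_0^\infty e^{-z\cosh u}\cosh(\nu u)\,du$ ($z>0$) be the modified Bessel function of the second kind. For $t\neq0$ put $$c_t=\frac{2\Gamma(2H)}{\Gamma(H+\frac12)^2(2\lambda|t|)^{2H}}-\frac{2}{\sqrt\pi\,\Gamma(H+\frac12)}\Bigl(\frac1{2\lambda|t|}\Bigr)^{H}K_H(\lambda|t|),\qquad c_0=0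 .$$ Then $B_{\alpha,\lambda}(t)$ is centred and square integrable for every $t$, and the following hold. 1. For all $s,t\in\mathbb R$, $$\langle B_{\alpha,\lambda}(t)B_{\alpha,\lambda}(s)\rangle=\tfrac12\bigl[c_t|t|^{2H}+c_s|s|^{2H}-c_{t-s}|t-s|^{2H}\bigr].$$ 2. This is the covariance of tempered fractional Brownian motion up to the factor $\Gamma(H+\frac12)^{-2}$. That is, let $$Z_{H,\lambda}(t)=\int_{\mathbb R}\Bigl[e^{-\lambda(t-u)_+}(t-u)_+^{H-1/2}-e^{-\lambda(-u)_+}(-u)_+^{H-1/2}\Bigr]\eta'(u)\,du,$$ where $0^0=0$ and $\eta'$ is any Gaussian white noise on $\mathbb R$, possibly on another probability space. Then $Z_{H,\lambda}(t)$ is centred and square integrable for every $t$, and for all $s,t\in\mathbb R$ $$\langle B_{\alpha,\lambda}(t)B_{\alpha,\lambda}(s)\rangle=\Gamma(H+\tfrac12)^{-2}\,\langle Z_{H,\lambda}(t)Z_{H,\lambda}(s)\rangle.$$ 3. Let $$\sigma^2=\frac{\Gamma(2\alpha-1)}{\Gamma(\alpha)^2(2\lambda)^{2\alpha-1}},\qquad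 C(\tau)=\frac1{\sqrt\pi\,\Gamma(\alpha)}\Bigl(\frac{|\tau|}{2\lambda}\Bigr)^{\alpha-1/2}K_{\alpha-1/2}(\lambda|\tau|)\ \ (\tau\ne0),\qquad C(0)=\sigma^2 .$$ Then for all $s,t\in\mathbb R$, $X_{\alpha,\lambda}(t)$ and $X_{\alpha,\lambda}(s)$ have covariance $C(t-s)$, $X_{\alpha,\lambda}(t)$ has variance $\sigma^2$, and $$\langle B_{\alpha,\lambda}(t)^2\rangle=2\bigl(\sigma^2-C(t)\bigr).$$ For $t\neq0$ this variance equals $$\frac{2\Gamma(2H)}{\Gamma(H+\frac12)^2(2\lambda)^{2H}}-\frac{2}{\sqrt\pi\,\Gamma(H+\frac12)}\Bigl(\frac{|t|}{2\lambda}\Bigr)^{H}K_H(\lambda|t|).$$ -/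

import Mathlib

open MeasureTheory ProbabilityTheory
open scoped ENNReal

noncomputable section

/-- Borel subsets of the line with finite Lebesgue measure. -/
abbrev FinBorel : Type := {A : Set ℝ // MeasurableSet A ∧ volume A < ∞}

/-- Gaussian white noise on the line: a centred Gaussian family `η(A)`, indexed by the Borel sets of
finite Lebesgue measure, with `E[η(A) η(B)] = |A ∩ B|` (zero mean, delta-correlated covariance). -/
structure GaussianWhiteNoise {Ω : Type*} [MeasurableSpace Ω] (P : Measure Ω) where
  toFun : FinBorel → Ω → ℝ
  gaussian : IsGaussianProcess toFun P
  mean_zero : ∀ A, ∫ ω, toFun A ω ∂P = 0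
  covariance : ∀ A B : FinBorel,
    ∫ ω, toFun A ω * toFun B ω ∂P = (volume : Measure ℝ).real ((A : Set ℝ) ∩ (B : Set ℝ))

namespace GaussianWhiteNoise

attribute [local instance] Lp.simpleFunc.module Lp.simpleFunc.isBoundedSMul

variable {Ω : Type*} [MeasurableSpace Ω] {P : Measure Ω} (η : GaussianWhiteNoise P)

theorem memLp_two (A : FinBorel) : MemLp (η.toFun A) 2 P :=
  (η.gaussian.hasGaussianLaw_eval A).memLp_two

/-- The value `η(A)` as a vector of `L²(Ω)`, extended by zero to all sets. -/
def vec (A : Set ℝ) : Lp ℝ 2 P :=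
  open Classical in
  if h : MeasurableSet A ∧ volume A < ∞ then (η.memLp_two ⟨A, h⟩).toLp (η.toFun ⟨A, h⟩) else 0

theorem inner_vec {A B : Set ℝ} (hA : MeasurableSet A ∧ volume A < ∞)
    (hB : MeasurableSet B ∧ volume B < ∞) :
    inner ℝ (η.vec A) (η.vec B) = (volume : Measure ℝ).real (A ∩ B) := by
  rw [← η.covariance ⟨A, hA⟩ ⟨B, hB⟩, L2.inner_def]
  apply integral_congr_ae
  rw [vec, vec, dif_pos hA, dif_pos hB]
  filter_upwards [(η.memLp_two ⟨A, hA⟩).coeFn_toLp, (η.memLp_two ⟨B, hB⟩).coeFn_toLp] with ω h1 h2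
  rw [h1, h2]
  simp [mul_comm]

/-- The map `x ↦ x • η(A)`, the form in which Mathlib integrates simple functions. -/
def vecMap (A : Set ℝ) : ℝ →L[ℝ] Lp ℝ 2 P := ContinuousLinearMap.toSpanSingleton ℝ (η.vec A)

theorem vecMap_add : FinMeasAdditive volume η.vecMap := by
  intro A B hA hB hAf hBf hAB
  have hA' : MeasurableSet A ∧ volume A < ∞ := ⟨hA, hAf.lt_top⟩
  have hB' : MeasurableSet B ∧ volume B < ∞ := ⟨hB, hBf.lt_top⟩
  have hU : MeasurableSet (A ∪ B) ∧ volume (A ∪ B) < ∞ :=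
    ⟨hA.union hB, measure_union_lt_top hA'.2 hB'.2⟩
  have key : η.vec (A ∪ B) = η.vec A + η.vec B := by
    have hvol := measureReal_union (μ := (volume : Measure ℝ)) hAB hB
    have hd : A ∩ B = ∅ := hAB.inter_eq
    rw [← sub_eq_zero, ← inner_self_eq_zero (𝕜 := ℝ)]
    simp only [inner_sub_left, inner_sub_right, inner_add_left, inner_add_right,
      η.inner_vec hA' hA', η.inner_vec hA' hB', η.inner_vec hB' hA', η.inner_vec hB' hB',
      η.inner_vec hU hU, η.inner_vec hU hA', η.inner_vec hU hB', η.inner_vec hA' hU,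
      η.inner_vec hB' hU, Set.inter_self, Set.union_inter_cancel_left,
      Set.union_inter_cancel_right, Set.inter_comm B A, hd, measureReal_empty,
      Set.inter_union_distrib_left, Set.empty_union, Set.union_empty, hvol]
    ring
  ext1
  simp [vecMap, key]

theorem vecMap_zero : ∀ A, MeasurableSet A → volume A = 0 → η.vecMap A = 0 := by
  intro A hA h0
  have h : MeasurableSet A ∧ volume A < ∞ := ⟨hA, by simp [h0]⟩
  have : η.vec A = 0 := by
    rw [← inner_self_eq_zero (𝕜 := ℝ), η.inner_vec h h]
    simp [measureReal_def, h0]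
  ext1
  simp [vecMap, this]

/-- `∑ xᵢ 1_{Aᵢ} ↦ ∑ xᵢ η(Aᵢ)` on simple functions in `L²(ℝ)`. -/
def simpleIntegral : Lp.simpleFunc ℝ 2 (volume : Measure ℝ) →ₗ[ℝ] Lp ℝ 2 P where
  toFun f := (Lp.simpleFunc.toSimpleFunc f).setToSimpleFunc η.vecMap
  map_add' f g := by
    have hi : ∀ f : Lp.simpleFunc ℝ 2 (volume : Measure ℝ),
        Integrable (Lp.simpleFunc.toSimpleFunc f) volume := fun f =>
      (SimpleFunc.memLp_iff_integrable two_ne_zero ENNReal.ofNat_ne_top).1 (Lp.simpleFunc.memLp f)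
    rw [← SimpleFunc.setToSimpleFunc_add _ η.vecMap_add (hi f) (hi g)]
    exact SimpleFunc.setToSimpleFunc_congr _ η.vecMap_zero η.vecMap_add (hi _)
      (Lp.simpleFunc.add_toSimpleFunc f g)
  map_smul' c f := by
    have hi : ∀ f : Lp.simpleFunc ℝ 2 (volume : Measure ℝ),
        Integrable (Lp.simpleFunc.toSimpleFunc f) volume := fun f =>
      (SimpleFunc.memLp_iff_integrable two_ne_zero ENNReal.ofNat_ne_top).1 (Lp.simpleFunc.memLp f)
    rw [RingHom.id_apply, ← SimpleFunc.setToSimpleFunc_smul_real _ η.vecMap_add c (hi f)]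
    exact SimpleFunc.setToSimpleFunc_congr _ η.vecMap_zero η.vecMap_add (hi _)
      (Lp.simpleFunc.smul_toSimpleFunc c f)

theorem norm_simpleIntegral (f : Lp.simpleFunc ℝ 2 (volume : Measure ℝ)) :
    ‖η.simpleIntegral f‖ = ‖f‖ := by
  classical
  set g := Lp.simpleFunc.toSimpleFunc f with hg
  have hm : ∀ x : ℝ, x ≠ 0 → MeasurableSet (g ⁻¹' {x}) ∧ volume (g ⁻¹' {x}) < ∞ := fun x hx =>
    ⟨g.measurableSet_fiber x, SimpleFunc.measure_preimage_lt_top_of_memLp two_ne_zero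
      ENNReal.ofNat_ne_top g (Lp.simpleFunc.memLp f) x hx⟩
  have h1 : ‖η.simpleIntegral f‖ ^ 2 =
      ∑ x ∈ g.range with x ≠ 0, x ^ 2 * (volume : Measure ℝ).real (g ⁻¹' {x}) := by
    rw [← real_inner_self_eq_norm_sq]
    change inner ℝ (g.setToSimpleFunc η.vecMap) (g.setToSimpleFunc η.vecMap) = _
    rw [SimpleFunc.setToSimpleFunc_eq_sum_filter, sum_inner]
    refine Finset.sum_congr rfl fun x hx => ?_
    rw [inner_sum, Finset.sum_eq_single x]
    · have hx0 := (Finset.mem_filter.1 hx).2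
      simp only [vecMap, ContinuousLinearMap.toSpanSingleton_apply, real_inner_smul_left,
        real_inner_smul_right, η.inner_vec (hm x hx0) (hm x hx0), Set.inter_self]
      ring
    · intro y hy hyx
      have hx0 := (Finset.mem_filter.1 hx).2
      have hy0 := (Finset.mem_filter.1 hy).2
      have hd : (g ⁻¹' {x}) ∩ (g ⁻¹' {y}) = ∅ := by
        ext u
        simp only [Set.mem_inter_iff, Set.mem_preimage, Set.mem_singleton_iff,
          Set.mem_empty_iff_false, iff_false, not_and]
        intro h h'
        exact hyx (h'.symm.trans h)
      simp [vecMap, ContinuousLinearMap.toSpanSingleton_apply, real_inner_smul_left,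
        real_inner_smul_right, η.inner_vec (hm x hx0) (hm y hy0), hd]
    · intro h
      exact absurd hx h
  have h2 : ‖f‖ ^ 2 = ∑ x ∈ g.range with x ≠ 0, x ^ 2 * (volume : Measure ℝ).real (g ⁻¹' {x}) := by
    have e1 : ‖f‖ ^ 2 = ∫ u, (g u) ^ 2 := by
      change ‖(f : Lp ℝ 2 (volume : Measure ℝ))‖ ^ 2 = _
      rw [← real_inner_self_eq_norm_sq, L2.inner_def]
      apply integral_congr_ae
      filter_upwards [Lp.simpleFunc.toSimpleFunc_eq_toFun f] with u hu
      rw [hg, hu]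
      simp [sq]
    have hi : Integrable g volume :=
      (SimpleFunc.memLp_iff_integrable two_ne_zero ENNReal.ofNat_ne_top).1 (Lp.simpleFunc.memLp f)
    have e2 : (fun u => (g u) ^ 2) = g.map (fun x => x ^ 2) := by
      ext u; simp
    rw [e1, e2, ← SimpleFunc.integral_eq_integral _
      (by
        rw [← e2]
        exact (Lp.simpleFunc.memLp f).integrable_sq), SimpleFunc.map_integral g _ hi (by simp),
      Finset.sum_filter]
    refine Finset.sum_congr rfl fun x _ => ?_
    by_cases hx : x = 0 <;> simp [hx, mul_comm]
  have := h1.trans h2.symm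
  exact (sq_eq_sq₀ (norm_nonneg _) (norm_nonneg _)).1 this

/-- The stochastic integral `f ↦ ∫ f(u) η(u) du` on `L²(ℝ)`: the continuous linear extension of the
integral of simple functions. -/
def integralL2 : Lp ℝ 2 (volume : Measure ℝ) →L[ℝ] Lp ℝ 2 P :=
  (η.simpleIntegral.mkContinuous 1 fun f => by
    rw [one_mul, η.norm_simpleIntegral f]).extend
    (Lp.simpleFunc.coeToLp ℝ ℝ ℝ : Lp.simpleFunc ℝ 2 (volume : Measure ℝ) →L[ℝ] _)

/-- The stochastic integral `∫ f(u) η(u) du` of a square integrable function `f`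
(zero by convention for other functions). -/
def integral (f : ℝ → ℝ) : Ω → ℝ :=
  open Classical in
  if h : MemLp f 2 volume then η.integralL2 (h.toLp f) else 0

end GaussianWhiteNoise

/-- The modified Bessel function of the second kind, `K_ν(z) = ∫_0^∞ e^{-z cosh u} cosh(ν u) du`
for `z > 0`. -/
def besselK (ν z : ℝ) : ℝ :=
  ∫ u in Set.Ioi (0 : ℝ), Real.exp (-z * Real.cosh u) * Real.cosh (ν * u)

/-- The tempered power `e^{-λ v} v_+^p`, equal to zero for `v ≤ 0`. -/
def temperedPow (p lam v : ℝ) : ℝ := if 0 < v then Real.exp (-lam * v) * v ^ p else 0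

section Processes

variable {Ω : Type*} [MeasurableSpace Ω] {P : Measure Ω} (η : GaussianWhiteNoise P)

/-- The Weyl fractional Ornstein–Uhlenbeck process
`X_{α,λ}(t) = Γ(α)⁻¹ ∫_{-∞}^t e^{-λ(t-u)} (t-u)^{α-1} η(u) du`. -/
def fou (α lam t : ℝ) : Ω → ℝ := fun ω =>
  (Real.Gamma α)⁻¹ * η.integral (fun u => temperedPow (α - 1) lam (t - u)) ω

/-- The reduced fractional Ornstein–Uhlenbeck process `B_{α,λ}(t) = X_{α,λ}(t) - X_{α,λ}(0)`. -/
def rfou (α lam t : ℝ) : Ω → ℝ := fun ω => fou η α lam t ω - fou η α lam 0 ω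

/-- Tempered fractional Brownian motion with Hurst parameter `H` and tempering parameter `λ`:
`∫ [e^{-λ(t-u)_+} (t-u)_+^{H-1/2} - e^{-λ(-u)_+} (-u)_+^{H-1/2}] η(u) du`, where `0^0 = 0`. -/
def tfbm (H lam t : ℝ) : Ω → ℝ :=
  η.integral (fun u => temperedPow (H - 1 / 2) lam (t - u) - temperedPow (H - 1 / 2) lam (-u))

end Processes

/-- `σ²_{α,λ} = Γ(2α-1) / (Γ(α)² (2λ)^{2α-1})`. -/
def fouVar (α lam : ℝ) : ℝ :=
  Real.Gamma (2 * α - 1) / (Real.Gamma α ^ 2 * (2 * lam) ^ (2 * α - 1))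

/-- `C_{α,λ}(τ) = (√π Γ(α))⁻¹ (|τ|/(2λ))^{α-1/2} K_{α-1/2}(λ|τ|)` for `τ ≠ 0`, with its limiting
value `σ²_{α,λ}` at `τ = 0`. -/
def fouCov (α lam τ : ℝ) : ℝ :=
  open Classical in
  if τ = 0 then fouVar α lam
  else 1 / (√Real.pi * Real.Gamma α) * (|τ| / (2 * lam)) ^ (α - 1 / 2) *
    besselK (α - 1 / 2) (lam * |τ|)

/-- `c_t = 2Γ(2H) / (Γ(H+1/2)² (2λ|t|)^{2H}) - 2 / (√π Γ(H+1/2)) (1/(2λ|t|))^H K_H(λ|t|)` for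
`t ≠ 0`, and `c_0 = 0`. -/
def rfouCoeff (H lam t : ℝ) : ℝ :=
  open Classical in
  if t = 0 then 0
  else 2 * Real.Gamma (2 * H) / (Real.Gamma (H + 1 / 2) ^ 2 * (2 * lam * |t|) ^ (2 * H)) -
    2 / (√Real.pi * Real.Gamma (H + 1 / 2)) * (1 / (2 * lam * |t|)) ^ H * besselK H (lam * |t|)

end

/-!
The stochastic integral maps `L²(ℝ)` isometrically into the centred part of `L²(Ω)`
(`covariance_integral`, `integral_integral`), so every covariance in the theorem is an overlap
integral of kernels `v ↦ e^{-λ v} v_+^{α-1}`, which are square integrable because `2(α-1) > -1`.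
The kernels of `Γ(α) B` and of tempered fractional Brownian motion agree, and bilinearity reduces
everything to the single identity `integral_temperedPow_mul_temperedPow`: the overlap of the kernels
at times `t` and `s` is `Γ(α)² C(t - s)`.

At `t = s` this is a Gamma integral. For `τ = t - s > 0` it is Basset's integral
`∫₀^∞ e^{-λ(2v+τ)} (v(v+τ))^{α-1} dv = Γ(α) π^{-1/2} (τ/2λ)^{α-1/2} K_{α-1/2}(λτ)`
(`integral_exp_mul_rpow_eq_besselK`). Put `r = 2v + τ` and `w = v(v+τ)`, so that `dw = r dv` and
`r² = 4w + τ²`. The closed form of `K_{1/2}` gives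
`e^{-λr} = (λ/2πτ)^{1/2} r ∫ exp(u/2 - (λ/2τ) r² e^u - (λτ/2) e^{-u}) du`,
where the factor `r` is the Jacobian. After Tonelli, the integral in `w` is a Gamma integral
and the one left in `u` is the defining integral of `K_{α-1/2}`. All of this is done with Lebesgue
integrals of nonnegative functions, so that no convergence has to be checked in the exchange.
-/

/-! ### The stochastic integral is a centred isometry -/

namespace GaussianWhiteNoise

attribute [local instance] Lp.simpleFunc.module Lp.simpleFunc.isBoundedSMul

variable {Ω : Type*} [MeasurableSpace Ω] {P : Measure Ω} (η : GaussianWhiteNoise P)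

theorem integralL2_coe (f : Lp.simpleFunc ℝ 2 (volume : Measure ℝ)) :
    η.integralL2 (f : Lp ℝ 2 (volume : Measure ℝ)) = η.simpleIntegral f := by
  have h := ContinuousLinearMap.extend_eq
    (η.simpleIntegral.mkContinuous 1 fun f => by rw [one_mul, η.norm_simpleIntegral f])
    (e := (Lp.simpleFunc.coeToLp ℝ ℝ ℝ :
      Lp.simpleFunc ℝ 2 (volume : Measure ℝ) →L[ℝ] Lp ℝ 2 (volume : Measure ℝ)))
    (Lp.simpleFunc.denseRange ENNReal.ofNat_ne_top) Lp.simpleFunc.isUniformInducing f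
  exact h

theorem norm_integralL2 (f : Lp ℝ 2 (volume : Measure ℝ)) : ‖η.integralL2 f‖ = ‖f‖ := by
  refine (Lp.simpleFunc.denseRange (E := ℝ) (p := 2) (μ := (volume : Measure ℝ))
    ENNReal.ofNat_ne_top).induction_on (p := fun f => ‖η.integralL2 f‖ = ‖f‖) f ?_ ?_
  · exact isClosed_eq (by fun_prop) (by fun_prop)
  · intro g
    rw [η.integralL2_coe, η.norm_simpleIntegral]
    rfl

theorem inner_integralL2 (f g : Lp ℝ 2 (volume : Measure ℝ)) :
    inner ℝ (η.integralL2 f) (η.integralL2 g) = inner ℝ f g :=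
  LinearIsometry.inner_map_map
    (⟨(η.integralL2 : Lp ℝ 2 (volume : Measure ℝ) →ₗ[ℝ] Lp ℝ 2 P), η.norm_integralL2⟩ :
      Lp ℝ 2 (volume : Measure ℝ) →ₗᵢ[ℝ] Lp ℝ 2 P) f g

theorem integral_vec (A : Set ℝ) : ∫ ω, (η.vec A) ω ∂P = 0 := by
  by_cases h : MeasurableSet A ∧ volume A < ∞
  · rw [← η.mean_zero ⟨A, h⟩, vec, dif_pos h]
    exact integral_congr_ae (η.memLp_two ⟨A, h⟩).coeFn_toLp
  · rw [vec, dif_neg h, integral_congr_ae (Lp.coeFn_zero ℝ 2 P)]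
    simp

/-- Taking the mean is pairing with the constant function `1` of `L²(Ω)`, so it commutes with the
sums that define the integral of a simple function and with limits in `L²`. -/
theorem integral_integralL2 [IsFiniteMeasure P] (f : Lp ℝ 2 (volume : Measure ℝ)) :
    ∫ ω, (η.integralL2 f) ω ∂P = 0 := by
  have hmean : ∀ F : Lp ℝ 2 P, ∫ ω, F ω ∂P =
      inner ℝ (indicatorConstLp 2 MeasurableSet.univ (measure_ne_top P Set.univ) (1 : ℝ)) F := by
    intro F
    rw [L2.inner_indicatorConstLp_one, setIntegral_univ]
  rw [hmean]
  refine (Lp.simpleFunc.denseRange (E := ℝ) (p := 2) (μ := (volume : Measure ℝ))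
    ENNReal.ofNat_ne_top).induction_on (p := fun f => inner ℝ (indicatorConstLp 2
      MeasurableSet.univ (measure_ne_top P Set.univ) (1 : ℝ)) (η.integralL2 f) = 0) f ?_ ?_
  · exact isClosed_eq (by fun_prop) (by fun_prop)
  · intro g
    rw [η.integralL2_coe]
    change inner ℝ _ ((Lp.simpleFunc.toSimpleFunc g).setToSimpleFunc η.vecMap) = 0
    rw [SimpleFunc.setToSimpleFunc, inner_sum]
    refine Finset.sum_eq_zero fun x _ => ?_
    rw [vecMap, ContinuousLinearMap.toSpanSingleton_apply, real_inner_smul_right, ← hmean,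
      η.integral_vec, mul_zero]

theorem integral_eq_integralL2 {f : ℝ → ℝ} (hf : MemLp f 2 volume) :
    η.integral f = ⇑(η.integralL2 (hf.toLp f)) := by
  rw [GaussianWhiteNoise.integral, dif_pos hf]

theorem memLp_integral {f : ℝ → ℝ} (hf : MemLp f 2 volume) : MemLp (η.integral f) 2 P := by
  rw [η.integral_eq_integralL2 hf]
  exact Lp.memLp _

theorem integral_integral [IsFiniteMeasure P] {f : ℝ → ℝ} (hf : MemLp f 2 volume) :
    ∫ ω, η.integral f ω ∂P = 0 := by
  rw [η.integral_eq_integralL2 hf]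
  exact η.integral_integralL2 _

/-- The Itô isometry in polarised form, for the stochastic integral of functions. -/
theorem covariance_integral [IsProbabilityMeasure P] {f g : ℝ → ℝ} (hf : MemLp f 2 volume)
    (hg : MemLp g 2 volume) : cov[η.integral f, η.integral g; P] = ∫ u, f u * g u := by
  rw [covariance_eq_sub (η.memLp_integral hf) (η.memLp_integral hg), η.integral_integral hf,
    zero_mul, sub_zero, η.integral_eq_integralL2 hf, η.integral_eq_integralL2 hg]
  have h1 : ∫ ω, (⇑(η.integralL2 (hf.toLp f)) * ⇑(η.integralL2 (hg.toLp g))) ω ∂P =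
      inner ℝ (η.integralL2 (hf.toLp f)) (η.integralL2 (hg.toLp g)) := by
    rw [L2.inner_def]
    exact integral_congr_ae (.of_forall fun ω => by simp [mul_comm])
  rw [h1, η.inner_integralL2, L2.inner_def]
  apply integral_congr_ae
  filter_upwards [hf.coeFn_toLp, hg.coeFn_toLp] with u hu hv
  simp [hu, hv, mul_comm]

end GaussianWhiteNoise

/-! ### An integral representation of the Bessel function -/

/-- Averaging over `u ↦ -u` turns the hyperbolic cosine into an exponential. -/
theorem lintegral_exp_neg_mul_cosh_mul_cosh (ν z : ℝ) :
    ∫⁻ u : ℝ, ENNReal.ofReal (Real.exp (-z * Real.cosh u) * Real.cosh (ν * u)) =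
      ∫⁻ u : ℝ, ENNReal.ofReal (Real.exp (ν * u - z * Real.cosh u)) := by
  have hneg : ∫⁻ u : ℝ, ENNReal.ofReal (Real.exp (-(ν * u) - z * Real.cosh u)) =
      ∫⁻ u : ℝ, ENNReal.ofReal (Real.exp (ν * u - z * Real.cosh u)) := by
    rw [← lintegral_neg_eq_self]
    simp
  have hadd : 2 * ∫⁻ u : ℝ, ENNReal.ofReal (Real.exp (-z * Real.cosh u) * Real.cosh (ν * u)) =
      2 * ∫⁻ u : ℝ, ENNReal.ofReal (Real.exp (ν * u - z * Real.cosh u)) := by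
    nth_rewrite 2 [two_mul]
    nth_rewrite 1 [← hneg]
    rw [← lintegral_add_left (by fun_prop), ← lintegral_const_mul _ (by fun_prop)]
    refine lintegral_congr fun u => ?_
    rw [← ENNReal.ofReal_add (by positivity) (by positivity),
      show (2 : ℝ≥0∞) = ENNReal.ofReal 2 by simp, ← ENNReal.ofReal_mul (by positivity)]
    congr 1
    rw [Real.cosh_eq (ν * u), sub_eq_add_neg, sub_eq_add_neg, Real.exp_add, Real.exp_add, neg_mul]
    ring
  exact (ENNReal.mul_right_inj two_ne_zero ENNReal.ofNat_ne_top).1 hadd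

theorem two_mul_besselK (ν z : ℝ) :
    2 * besselK ν z = (∫⁻ u : ℝ, ENNReal.ofReal (Real.exp (ν * u - z * Real.cosh u))).toReal := by
  rw [← lintegral_exp_neg_mul_cosh_mul_cosh, besselK, ← integral_comp_abs
    (f := fun u => Real.exp (-z * Real.cosh u) * Real.cosh (ν * u)),
    ← integral_eq_lintegral_of_nonneg_ae (.of_forall fun u => by positivity) (by fun_prop)]
  refine integral_congr_ae (.of_forall fun u => ?_)
  rcases abs_choice u with h | h <;> simp [h]

/-- The closed form of `K_{1/2}`: as `cosh u = 1 + 2 sinh (u/2)²`, the substitution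
`y = sinh (u/2)` makes the integral Gaussian. -/
theorem lintegral_exp_half_sub_mul_cosh {w : ℝ} (hw : 0 < w) :
    ∫⁻ u : ℝ, ENNReal.ofReal (Real.exp (1 / 2 * u - w * Real.cosh u)) =
      ENNReal.ofReal (√(2 * Real.pi / w) * Real.exp (-w)) := by
  rw [← lintegral_exp_neg_mul_cosh_mul_cosh]
  have hsub := lintegral_image_eq_lintegral_abs_deriv_mul (s := Set.univ)
    (f := fun u => Real.sinh (u / 2)) (f' := fun u => Real.cosh (u / 2) * (1 / 2))
    MeasurableSet.univ
    (fun u _ => (((hasDerivAt_id u).div_const 2).sinh).hasDerivWithinAt)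
    (fun u _ v _ h => by
      have := Real.sinh_injective h
      linarith)
    (fun y => ENNReal.ofReal (2 * Real.exp (-w) * Real.exp (-(2 * w) * y ^ 2)))
  have himg : (fun u : ℝ => Real.sinh (u / 2)) '' Set.univ = Set.univ := by
    rw [Set.image_univ, Set.range_eq_univ]
    intro y
    obtain ⟨x, hx⟩ := Real.sinh_surjective y
    exact ⟨2 * x, by simpa using hx⟩
  rw [himg, setLIntegral_univ, setLIntegral_univ] at hsub
  have hint := (integrable_exp_neg_mul_sq (b := 2 * w) (by positivity)).const_mul
    (2 * Real.exp (-w))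
  rw [← ofReal_integral_eq_lintegral_ofReal hint (.of_forall fun y => by positivity),
    integral_const_mul, integral_gaussian] at hsub
  have hconst : 2 * Real.exp (-w) * √(Real.pi / (2 * w)) =
      √(2 * Real.pi / w) * Real.exp (-w) := by
    rw [show 2 * Real.pi / w = 2 ^ 2 * (Real.pi / (2 * w)) by field_simp,
      Real.sqrt_mul (by positivity), Real.sqrt_sq (by positivity)]
    ring
  rw [← hconst, hsub]
  refine lintegral_congr fun u => ?_
  rw [← ENNReal.ofReal_mul (abs_nonneg _), abs_of_pos (by positivity)]
  congr 1
  have hcosh : Real.cosh u = 1 + 2 * Real.sinh (u / 2) ^ 2 := by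
    have h2 := Real.cosh_two_mul (u / 2)
    rw [mul_div_cancel₀ u two_ne_zero] at h2
    rw [h2, Real.cosh_sq]
    ring
  rw [hcosh, show -w * (1 + 2 * Real.sinh (u / 2) ^ 2) =
    -w + -(2 * w) * Real.sinh (u / 2) ^ 2 by ring, Real.exp_add,
    show 1 / 2 * u = u / 2 by ring]
  ring

/-- An exponential in `r` as a mixture of Gaussians in `r`: the closed form of `K_{1/2}` at
`lam * r`, after translating the variable of integration by `log (r / τ)`. -/
theorem ofReal_exp_neg_mul_eq_lintegral {lam τ r : ℝ} (hlam : 0 < lam) (hτ : 0 < τ) (hr : 0 < r) :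
    ENNReal.ofReal (Real.exp (-(lam * r))) =
      ∫⁻ u : ℝ, ENNReal.ofReal (√(lam / (2 * Real.pi * τ)) * r *
        Real.exp (1 / 2 * u - lam * r ^ 2 / (2 * τ) * Real.exp u -
          lam * τ / 2 * Real.exp (-u))) := by
  have hw : 0 < lam * r := by positivity
  have hrτ : 0 < r / τ := by positivity
  have h := lintegral_exp_half_sub_mul_cosh hw
  rw [← lintegral_add_right_eq_self _ (Real.log (r / τ))] at h
  have hc : Real.exp (-(lam * r)) = √(lam * r / (2 * Real.pi)) *
      (√(2 * Real.pi / (lam * r)) * Real.exp (-(lam * r))) := by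
    rw [← mul_assoc, ← Real.sqrt_mul (by positivity),
      show lam * r / (2 * Real.pi) * (2 * Real.pi / (lam * r)) = 1 by field_simp]
    simp
  rw [hc, ENNReal.ofReal_mul (by positivity), ← h, ← lintegral_const_mul _ (by fun_prop)]
  refine lintegral_congr fun u => ?_
  rw [← ENNReal.ofReal_mul (by positivity)]
  congr 1
  have hhalf : Real.exp (1 / 2 * Real.log (r / τ)) = √(r / τ) := by
    rw [Real.sqrt_eq_rpow, Real.rpow_def_of_pos hrτ, mul_comm]
  have hsq : √(lam * r / (2 * Real.pi)) * √(r / τ) = √(lam / (2 * Real.pi * τ)) * r := by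
    rw [← Real.sqrt_mul (by positivity), show lam * r / (2 * Real.pi) * (r / τ) =
      lam / (2 * Real.pi * τ) * r ^ 2 by field_simp, Real.sqrt_mul (by positivity),
      Real.sqrt_sq hr.le]
  rw [← hsq, ← hhalf, mul_assoc √(lam * r / (2 * Real.pi)), ← Real.exp_add, Real.cosh_eq, neg_add,
    Real.exp_add u, Real.exp_add (-u), Real.exp_neg (Real.log (r / τ)), Real.exp_log hrτ]
  congr 2
  field_simp
  ring

/-- The Gamma integral in `w = v (v + τ)`, for which `(2 v + τ)² = 4 w + τ²`. -/
theorem lintegral_two_mul_add_mul_rpow_mul_exp {α b τ : ℝ} (hα : 0 < α) (hb : 0 < b)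
    (hτ : 0 < τ) :
    ∫⁻ v in Set.Ioi (0 : ℝ), ENNReal.ofReal ((2 * v + τ) * (v * (v + τ)) ^ (α - 1) *
      Real.exp (-(b * (2 * v + τ) ^ 2))) =
      ENNReal.ofReal (Real.exp (-(b * τ ^ 2)) * ((1 / (4 * b)) ^ α * Real.Gamma α)) := by
  have hmono : StrictMonoOn (fun v : ℝ => v * (v + τ)) (Set.Ici 0) := by
    intro x hx y hy hxy
    simp only [Set.mem_Ici] at hx hy
    change x * (x + τ) < y * (y + τ)
    nlinarith
  have hsub := lintegral_image_eq_lintegral_abs_deriv_mul (s := Set.Ioi (0 : ℝ))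
    (f := fun v => v * (v + τ)) (f' := fun v => 1 * (v + τ) + v * 1) measurableSet_Ioi
    (fun v _ => ((hasDerivAt_id v).mul ((hasDerivAt_id v).add_const τ)).hasDerivWithinAt)
    (hmono.injOn.mono Set.Ioi_subset_Ici_self)
    (fun w => ENNReal.ofReal (Real.exp (-(b * τ ^ 2)) *
      (w ^ (α - 1) * Real.exp (-(4 * b * w)))))
  have himg : (fun v : ℝ => v * (v + τ)) '' Set.Ioi 0 = Set.Ioi 0 := by
    ext w
    simp only [Set.mem_image, Set.mem_Ioi]
    constructor
    · rintro ⟨v, hv, rfl⟩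
      positivity
    · intro hw
      -- the positive root of `v ^ 2 + τ * v = w`
      have hs : √(τ ^ 2 + 4 * w) ^ 2 = τ ^ 2 + 4 * w := Real.sq_sqrt (by positivity)
      have hlt : τ < √(τ ^ 2 + 4 * w) := Real.lt_sqrt_of_sq_lt (by linarith)
      exact ⟨(√(τ ^ 2 + 4 * w) - τ) / 2, by linarith, by linear_combination hs / 4⟩
  have hint : IntegrableOn (fun w : ℝ => Real.exp (-(b * τ ^ 2)) *
      (w ^ (α - 1) * Real.exp (-(4 * b * w)))) (Set.Ioi 0) := by
    have := integrableOn_rpow_mul_exp_neg_mul_rpow (p := 1) (s := α - 1) (b := 4 * b)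
      (by linarith) one_pos (by positivity)
    simp only [Real.rpow_one, neg_mul] at this
    exact (this.const_mul _)
  rw [himg, ← ofReal_integral_eq_lintegral_ofReal hint
    ((ae_restrict_iff' measurableSet_Ioi).2 (.of_forall fun w (hw : 0 < w) => by
      positivity)), integral_const_mul,
    Real.integral_rpow_mul_exp_neg_mul_Ioi hα (by positivity)] at hsub
  rw [hsub]
  refine setLIntegral_congr_fun measurableSet_Ioi fun v (hv : 0 < v) => ?_
  rw [← ENNReal.ofReal_mul (abs_nonneg _), abs_of_pos (by positivity)]
  congr 1
  rw [show -(b * (2 * v + τ) ^ 2) = -(b * τ ^ 2) + -(4 * b * (v * (v + τ))) by ring, Real.exp_add]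
  ring

/-- Basset's integral for `K_{α-1/2}`, in the form in which it arises from the overlap of two
tempered powers. Expanding the exponential as a mixture of Gaussians in `2 v + τ` and exchanging
the integrals leaves a Gamma integral inside. -/
theorem integral_exp_mul_rpow_eq_besselK {α lam τ : ℝ} (hα : 0 < α) (hlam : 0 < lam)
    (hτ : 0 < τ) :
    ∫ v in Set.Ioi (0 : ℝ), Real.exp (-(lam * (2 * v + τ))) * (v * (v + τ)) ^ (α - 1) =
      Real.Gamma α / √Real.pi * (τ / (2 * lam)) ^ (α - 1 / 2) *
        besselK (α - 1 / 2) (lam * τ) := by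
  have hΓ := Real.Gamma_pos_of_pos hα
  set κ := √(lam / (2 * Real.pi * τ)) with hκ
  have hmain : ∫⁻ v in Set.Ioi (0 : ℝ), ENNReal.ofReal
      (Real.exp (-(lam * (2 * v + τ))) * (v * (v + τ)) ^ (α - 1)) =
      ENNReal.ofReal (κ * (τ / (2 * lam)) ^ α * Real.Gamma α) *
        ∫⁻ u : ℝ, ENNReal.ofReal (Real.exp ((-(α - 1 / 2)) * u - lam * τ * Real.cosh u)) := by
    have h1 : ∀ v ∈ Set.Ioi (0 : ℝ), ENNReal.ofReal
        (Real.exp (-(lam * (2 * v + τ))) * (v * (v + τ)) ^ (α - 1)) =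
        ∫⁻ u : ℝ, ENNReal.ofReal (κ * Real.exp (1 / 2 * u - lam * τ / 2 * Real.exp (-u)) *
          ((2 * v + τ) * (v * (v + τ)) ^ (α - 1) *
            Real.exp (-(lam / (2 * τ) * Real.exp u * (2 * v + τ) ^ 2)))) := by
      intro v hv
      have hv : 0 < v := hv
      rw [mul_comm, ENNReal.ofReal_mul (by positivity),
        ofReal_exp_neg_mul_eq_lintegral hlam hτ (by positivity : 0 < 2 * v + τ),
        ← lintegral_const_mul _ (by fun_prop)]
      refine lintegral_congr fun u => ?_
      rw [← ENNReal.ofReal_mul (by positivity)]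
      congr 1
      rw [show 1 / 2 * u - lam * (2 * v + τ) ^ 2 / (2 * τ) * Real.exp u -
        lam * τ / 2 * Real.exp (-u) = (1 / 2 * u - lam * τ / 2 * Real.exp (-u)) +
          -(lam / (2 * τ) * Real.exp u * (2 * v + τ) ^ 2) by ring, Real.exp_add]
      ring
    rw [setLIntegral_congr_fun measurableSet_Ioi h1, lintegral_lintegral_swap (by fun_prop),
      ← lintegral_const_mul _ (by fun_prop)]
    refine lintegral_congr fun u => ?_
    simp_rw [ENNReal.ofReal_mul (by positivity :
      0 ≤ κ * Real.exp (1 / 2 * u - lam * τ / 2 * Real.exp (-u)))]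
    rw [lintegral_const_mul _ (by fun_prop),
      lintegral_two_mul_add_mul_rpow_mul_exp hα (by positivity) hτ,
      ← ENNReal.ofReal_mul (by positivity), ← ENNReal.ofReal_mul (by positivity)]
    congr 1
    have hpow : (1 / (4 * (lam / (2 * τ) * Real.exp u))) ^ α =
        (τ / (2 * lam)) ^ α * Real.exp (-(α * u)) := by
      rw [show 1 / (4 * (lam / (2 * τ) * Real.exp u)) = τ / (2 * lam) * Real.exp (-u) by
        rw [Real.exp_neg]; field_simp; norm_num, Real.mul_rpow (by positivity) (by positivity),
        ← Real.exp_mul]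
      congr 2
      ring
    have hexp : Real.exp (1 / 2 * u - lam * τ / 2 * Real.exp (-u)) *
        Real.exp (-(lam / (2 * τ) * Real.exp u * τ ^ 2)) * Real.exp (-(α * u)) =
        Real.exp ((-(α - 1 / 2)) * u - lam * τ * Real.cosh u) := by
      rw [← Real.exp_add, ← Real.exp_add, Real.cosh_eq]
      congr 1
      field_simp
      ring
    rw [hpow, ← hexp]
    ring
  -- `K_ν` is even in `ν`
  have hflip : ∫⁻ u : ℝ, ENNReal.ofReal (Real.exp ((-(α - 1 / 2)) * u - lam * τ * Real.cosh u)) =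
      ∫⁻ u : ℝ, ENNReal.ofReal (Real.exp ((α - 1 / 2) * u - lam * τ * Real.cosh u)) := by
    rw [← lintegral_neg_eq_self]
    simp only [neg_mul_neg, Real.cosh_neg]
  rw [integral_eq_lintegral_of_nonneg_ae ((ae_restrict_iff' measurableSet_Ioi).2
    (.of_forall fun v (hv : 0 < v) => by positivity))
    (by fun_prop), hmain, hflip, ENNReal.toReal_mul, ← two_mul_besselK,
    ENNReal.toReal_ofReal (by positivity)]
  have hτl : 0 < τ / (2 * lam) := by positivity
  have hκ' : κ * √(τ / (2 * lam)) = 1 / (2 * √Real.pi) := by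
    rw [hκ, ← Real.sqrt_mul (by positivity), show lam / (2 * Real.pi * τ) * (τ / (2 * lam)) =
      (1 / 2) ^ 2 * (1 / Real.pi) by field_simp, Real.sqrt_mul (by positivity),
      Real.sqrt_sq (by positivity), Real.sqrt_div zero_le_one, Real.sqrt_one]
    field_simp
  have hsplit : (τ / (2 * lam)) ^ α = (τ / (2 * lam)) ^ (α - 1 / 2) * √(τ / (2 * lam)) := by
    rw [Real.sqrt_eq_rpow, ← Real.rpow_add hτl, sub_add_cancel]
  rw [hsplit]
  calc _ = (κ * √(τ / (2 * lam))) * (2 * Real.Gamma α * (τ / (2 * lam)) ^ (α - 1 / 2) *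
        besselK (α - 1 / 2) (lam * τ)) := by ring
    _ = _ := by
      rw [hκ']
      field_simp

/-! ### Overlaps of tempered powers -/

theorem measurable_temperedPow (p lam : ℝ) : Measurable (temperedPow p lam) :=
  Measurable.ite measurableSet_Ioi (by fun_prop) measurable_const

theorem temperedPow_sq (p lam v : ℝ) : temperedPow p lam v ^ 2 =
    (Set.Ioi (0 : ℝ)).indicator (fun v => v ^ (2 * p) * Real.exp (-(2 * lam * v))) v := by
  by_cases hv : 0 < v
  · rw [temperedPow, if_pos hv, Set.indicator_of_mem (Set.mem_Ioi.2 hv), mul_pow,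
      ← Real.rpow_mul_natCast hv.le, ← Real.exp_nat_mul]
    push_cast
    rw [mul_comm p 2, mul_comm]
    congr 2
    ring
  · rw [temperedPow, if_neg hv, Set.indicator_of_notMem (by simpa using hv)]
    simp

theorem temperedPow_add_mul (p lam : ℝ) {τ : ℝ} (hτ : 0 < τ) (v : ℝ) :
    temperedPow p lam (v + τ) * temperedPow p lam v =
      (Set.Ioi (0 : ℝ)).indicator
        (fun v => Real.exp (-(lam * (2 * v + τ))) * (v * (v + τ)) ^ p) v := by
  by_cases hv : 0 < v
  · have hvτ : 0 < v + τ := by positivity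
    rw [Set.indicator_of_mem (Set.mem_Ioi.2 hv), temperedPow, temperedPow, if_pos hv, if_pos hvτ,
      Real.mul_rpow hv.le hvτ.le,
      show -(lam * (2 * v + τ)) = -lam * (v + τ) + -lam * v by ring, Real.exp_add]
    ring
  · rw [Set.indicator_of_notMem (by simpa using hv)]
    simp [temperedPow, hv]

theorem memLp_temperedPow {p lam : ℝ} (hp : -1 < 2 * p) (hlam : 0 < lam) :
    MemLp (temperedPow p lam) 2 volume := by
  rw [memLp_two_iff_integrable_sq (measurable_temperedPow p lam).aestronglyMeasurable]
  simp_rw [temperedPow_sq]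
  rw [integrable_indicator_iff measurableSet_Ioi]
  have := integrableOn_rpow_mul_exp_neg_mul_rpow (p := 1) (s := 2 * p) (b := 2 * lam)
    hp one_pos (by positivity)
  simpa only [Real.rpow_one, neg_mul] using this

theorem memLp_temperedPow_sub_left {p lam : ℝ} (hp : -1 < 2 * p) (hlam : 0 < lam) (t : ℝ) :
    MemLp (fun u => temperedPow p lam (t - u)) 2 volume :=
  (memLp_temperedPow hp hlam).comp_measurePreserving
    (Measure.measurePreserving_sub_left volume t)

theorem memLp_tfbm_kernel {p lam : ℝ} (hp : -1 < 2 * p) (hlam : 0 < lam) (t : ℝ) :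
    MemLp (fun u => temperedPow p lam (t - u) - temperedPow p lam (-u)) 2 volume := by
  have h0 := memLp_temperedPow_sub_left hp hlam 0
  simp only [zero_sub] at h0
  exact (memLp_temperedPow_sub_left hp hlam t).sub h0

/-- The covariance function of the process as an overlap integral: a Gamma integral at `t = s`, a
Bessel function otherwise. -/
theorem integral_temperedPow_mul_temperedPow {α lam : ℝ} (hα : 1 / 2 < α) (hlam : 0 < lam)
    (t s : ℝ) :
    ∫ u, temperedPow (α - 1) lam (t - u) * temperedPow (α - 1) lam (s - u) =
      Real.Gamma α ^ 2 * fouCov α lam (t - s) := by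
  have hΓ : Real.Gamma α ≠ 0 := (Real.Gamma_pos_of_pos (by linarith)).ne'
  wlog hst : s ≤ t generalizing t s
  · have := this s t (le_of_not_ge hst)
    simp_rw [mul_comm (temperedPow (α - 1) lam (s - _))] at this
    rw [this]
    simp only [fouCov, abs_sub_comm s t, sub_eq_zero, eq_comm (a := s)]
  rw [← integral_sub_left_eq_self _ volume s]
  simp only [sub_sub_cancel]
  rcases hst.eq_or_lt with rfl | hlt
  · simp only [sub_sub_cancel, ← sq, temperedPow_sq, sub_self]
    rw [integral_indicator measurableSet_Ioi,
      show 2 * (α - 1) = (2 * α - 1) - 1 by ring,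
      Real.integral_rpow_mul_exp_neg_mul_Ioi (by linarith) (by positivity), fouCov, if_pos rfl,
      fouVar, Real.div_rpow zero_le_one (by positivity), Real.one_rpow]
    field_simp
  · have hτ : 0 < t - s := sub_pos.2 hlt
    have hshift : ∀ v, t - (s - v) = v + (t - s) := fun v => by ring
    simp only [hshift, temperedPow_add_mul _ _ hτ]
    rw [integral_indicator measurableSet_Ioi,
      integral_exp_mul_rpow_eq_besselK (by linarith) hlam hτ, fouCov, if_neg hτ.ne', abs_of_pos hτ]
    field_simp

theorem fouCov_neg (α lam τ : ℝ) : fouCov α lam (-τ) = fouCov α lam τ := by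
  simp [fouCov]

/-- The normalisation of `c_t` is such that `c_t |t|^{2H}` is the variance of the increment. -/
theorem rfouCoeff_mul_rpow {H lam : ℝ} (hH : 0 < H) (hlam : 0 < lam) (t : ℝ) :
    rfouCoeff H lam t * |t| ^ (2 * H) =
      2 * (fouVar (H + 1 / 2) lam - fouCov (H + 1 / 2) lam t) := by
  by_cases ht : t = 0
  · simp [rfouCoeff, fouCov, ht]
  have hat : 0 < |t| := abs_pos.2 ht
  have hpow : |t| ^ (2 * H) = |t| ^ H * |t| ^ H := by rw [two_mul, Real.rpow_add hat]
  have ht0 : |t| ^ H ≠ 0 := (Real.rpow_pos_of_pos hat _).ne'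
  rw [rfouCoeff, if_neg ht, fouVar, fouCov, if_neg ht, add_sub_cancel_right,
    show 2 * (H + 1 / 2) - 1 = 2 * H by ring, Real.mul_rpow (by positivity) hat.le,
    Real.div_rpow zero_le_one (by positivity), Real.one_rpow,
    Real.mul_rpow (by positivity) hat.le, Real.div_rpow hat.le (by positivity), hpow]
  have hl0 : (2 * lam) ^ H ≠ 0 := (Real.rpow_pos_of_pos (by positivity) _).ne'
  have hl1 : (2 * lam) ^ (2 * H) ≠ 0 := (Real.rpow_pos_of_pos (by positivity) _).ne'
  have hΓ : Real.Gamma (H + 1 / 2) ≠ 0 := (Real.Gamma_pos_of_pos (by positivity)).ne'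
  have hπ : √Real.pi ≠ 0 := by positivity
  field_simp

/-! ### Covariances of the processes -/

section Processes

variable {Ω : Type*} [MeasurableSpace Ω] {P : Measure Ω} (η : GaussianWhiteNoise P)
  {α lam : ℝ}

theorem memLp_fou (hα : 1 / 2 < α) (hlam : 0 < lam) (t : ℝ) : MemLp (fou η α lam t) 2 P :=
  (η.memLp_integral (memLp_temperedPow_sub_left (by linarith) hlam t)).const_mul _

theorem memLp_rfou (hα : 1 / 2 < α) (hlam : 0 < lam) (t : ℝ) : MemLp (rfou η α lam t) 2 P :=
  (memLp_fou η hα hlam t).sub (memLp_fou η hα hlam 0)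

variable [IsProbabilityMeasure P]

theorem integral_fou (hα : 1 / 2 < α) (hlam : 0 < lam) (t : ℝ) :
    ∫ ω, fou η α lam t ω ∂P = 0 := by
  simp_rw [fou]
  rw [integral_const_mul, η.integral_integral (memLp_temperedPow_sub_left (by linarith) hlam t),
    mul_zero]

theorem covariance_fou (hα : 1 / 2 < α) (hlam : 0 < lam) (t s : ℝ) :
    cov[fou η α lam t, fou η α lam s; P] = fouCov α lam (t - s) := by
  have hΓ : Real.Gamma α ≠ 0 := (Real.Gamma_pos_of_pos (by linarith)).ne'
  have hk := memLp_temperedPow_sub_left (p := α - 1) (by linarith) hlam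
  change cov[fun ω => _ * η.integral _ ω, fun ω => _ * η.integral _ ω; P] = _
  rw [covariance_const_mul_left, covariance_const_mul_right, η.covariance_integral (hk t) (hk s),
    integral_temperedPow_mul_temperedPow hα hlam]
  field_simp

theorem integral_rfou (hα : 1 / 2 < α) (hlam : 0 < lam) (t : ℝ) :
    ∫ ω, rfou η α lam t ω ∂P = 0 := by
  simp_rw [rfou]
  rw [integral_sub ((memLp_fou η hα hlam t).integrable one_le_two)
    ((memLp_fou η hα hlam 0).integrable one_le_two), integral_fou η hα hlam,
    integral_fou η hα hlam, sub_zero]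

theorem covariance_rfou (hα : 1 / 2 < α) (hlam : 0 < lam) (t s : ℝ) :
    cov[rfou η α lam t, rfou η α lam s; P] =
      fouCov α lam (t - s) - fouCov α lam t - fouCov α lam s + fouVar α lam := by
  have hm := memLp_fou η hα hlam
  change cov[fun ω => fou η α lam t ω - fou η α lam 0 ω,
    fun ω => fou η α lam s ω - fou η α lam 0 ω; P] = _
  rw [covariance_fun_sub_fun_sub (hm t) (hm 0) (hm s) (hm 0)]
  simp only [covariance_fou η hα hlam, sub_zero, zero_sub, fouCov_neg]
  rw [show fouCov α lam 0 = fouVar α lam from if_pos rfl]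

theorem covariance_tfbm (hα : 1 / 2 < α) (hlam : 0 < lam) (t s : ℝ) :
    cov[tfbm η (α - 1 / 2) lam t, tfbm η (α - 1 / 2) lam s; P] = Real.Gamma α ^ 2 *
      (fouCov α lam (t - s) - fouCov α lam t - fouCov α lam s + fouVar α lam) := by
  have hp : -1 < 2 * (α - 1) := by linarith
  rw [tfbm, tfbm, show α - 1 / 2 - 1 / 2 = α - 1 by ring,
    η.covariance_integral (memLp_tfbm_kernel hp hlam t) (memLp_tfbm_kernel hp hlam s)]
  have hk : ∀ a b : ℝ, Integrable
      (fun u => temperedPow (α - 1) lam (a - u) * temperedPow (α - 1) lam (b - u)) volume :=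
    fun a b => (memLp_temperedPow_sub_left hp hlam a).integrable_mul
      (memLp_temperedPow_sub_left hp hlam b)
  have hexpand : ∀ u : ℝ, (temperedPow (α - 1) lam (t - u) - temperedPow (α - 1) lam (-u)) *
      (temperedPow (α - 1) lam (s - u) - temperedPow (α - 1) lam (-u)) =
      temperedPow (α - 1) lam (t - u) * temperedPow (α - 1) lam (s - u) -
        temperedPow (α - 1) lam (t - u) * temperedPow (α - 1) lam (0 - u) -
        temperedPow (α - 1) lam (0 - u) * temperedPow (α - 1) lam (s - u) +
        temperedPow (α - 1) lam (0 - u) * temperedPow (α - 1) lam (0 - u) := fun u => by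
    rw [zero_sub]
    ring
  simp_rw [hexpand]
  rw [integral_add (((hk t s).sub' (hk t 0)).sub' (hk 0 s)) (hk 0 0),
    integral_sub ((hk t s).sub' (hk t 0)) (hk 0 s), integral_sub (hk t s) (hk t 0)]
  simp only [integral_temperedPow_mul_temperedPow hα hlam]
  simp only [sub_zero, zero_sub, fouCov_neg]
  have h0 : fouCov α lam 0 = fouVar α lam := if_pos rfl
  rw [h0]
  ring

end Processes

theorem mainTheorem1 {Ω Ω' : Type*} [MeasurableSpace Ω] [MeasurableSpace Ω']
    (P : Measure Ω) (P' : Measure Ω') [IsProbabilityMeasure P] [IsProbabilityMeasure P']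
    (η : GaussianWhiteNoise P) (η' : GaussianWhiteNoise P')
    (α H lam : ℝ) (hα : 1 / 2 < α) (hH : H = α - 1 / 2) (hlam : 0 < lam) :
    -- the reduced process is centred and square integrable
    (∀ t : ℝ, MemLp (rfou η α lam t) 2 P ∧ ∫ ω, rfou η α lam t ω ∂P = 0) ∧
    -- its covariance through `c_t`
    (∀ t s : ℝ, cov[rfou η α lam t, rfou η α lam s; P] =
      1 / 2 * (rfouCoeff H lam t * |t| ^ (2 * H) + rfouCoeff H lam s * |s| ^ (2 * H)
        - rfouCoeff H lam (t - s) * |t - s| ^ (2 * H))) ∧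
    -- it is the covariance of tempered fractional Brownian motion up to a constant factor
    (∀ t : ℝ, MemLp (tfbm η' H lam t) 2 P' ∧ ∫ ω, tfbm η' H lam t ω ∂P' = 0) ∧
    (∀ t s : ℝ, cov[rfou η α lam t, rfou η α lam s; P] =
      (Real.Gamma (H + 1 / 2) ^ 2)⁻¹ * cov[tfbm η' H lam t, tfbm η' H lam s; P']) ∧
    -- its variance, with `σ²` and `C` the variance and the covariance function of `X`
    (∀ t s : ℝ, cov[fou η α lam t, fou η α lam s; P] = fouCov α lam (t - s)) ∧
    (∀ t : ℝ, Var[fou η α lam t; P] = fouVar α lam) ∧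
    (∀ t : ℝ, Var[rfou η α lam t; P] = 2 * (fouVar α lam - fouCov α lam t)) ∧
    (∀ t : ℝ, t ≠ 0 → Var[rfou η α lam t; P] =
      2 * Real.Gamma (2 * H) / (Real.Gamma (H + 1 / 2) ^ 2 * (2 * lam) ^ (2 * H)) -
        2 / (√Real.pi * Real.Gamma (H + 1 / 2)) * (|t| / (2 * lam)) ^ H *
          besselK H (lam * |t|)) := by
  have hHα : H + 1 / 2 = α := by linarith
  have hHpos : 0 < H := by linarith
  have hΓ : Real.Gamma α ≠ 0 := (Real.Gamma_pos_of_pos (by linarith)).ne'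
  have h0 : fouCov α lam 0 = fouVar α lam := if_pos rfl
  have hcoeff : ∀ t, rfouCoeff H lam t * |t| ^ (2 * H) = 2 * (fouVar α lam - fouCov α lam t) :=
    fun t => by rw [rfouCoeff_mul_rpow hHpos hlam, hHα]
  have hvar : ∀ t, Var[rfou η α lam t; P] = 2 * (fouVar α lam - fouCov α lam t) := fun t => by
    rw [← covariance_self (memLp_rfou η hα hlam t).aestronglyMeasurable.aemeasurable,
      covariance_rfou η hα hlam, sub_self, h0]
    ring
  refine ⟨fun t => ⟨memLp_rfou η hα hlam t, integral_rfou η hα hlam t⟩, fun t s => ?_,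
    fun t => ?_, fun t s => ?_, covariance_fou η hα hlam, fun t => ?_, hvar, fun t ht => ?_⟩
  · rw [covariance_rfou η hα hlam, hcoeff, hcoeff, hcoeff]
    ring
  · have hk := memLp_tfbm_kernel (p := H - 1 / 2) (by linarith) hlam t
    exact ⟨η'.memLp_integral hk, η'.integral_integral hk⟩
  · rw [covariance_rfou η hα hlam, hHα, hH, covariance_tfbm η' hα hlam]
    field_simp
  · rw [← covariance_self (memLp_fou η hα hlam t).aestronglyMeasurable.aemeasurable,
      covariance_fou η hα hlam, sub_self, h0]
  · rw [hvar, fouVar, fouCov, if_neg ht, hHα, show 2 * α - 1 = 2 * H by linarith, ← hH]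
    ring
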